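/- Let $n=1$, $\frac12<s<1$ and $0<\ell<\infty$. Let $V:\mathbb R\to\mathbb R$ and $f:\mathbb R\times\mathbb C\to\mathbb C$ be measurable, with $f(x,z)=\frac{z}{|z|}f(x,|z|)$ for $z\neq0$, and let $a,b:\mathbb R\to[0,\infty)$ be measurable functions such that, for all $x\in\mathbb R$ and $z,z_1,z_2\in\mathbb C$, $$|f(x,z)|\le a(x)|z|^{\ell+1},\qquad |f(x,z_1)-f(x,z_2)|\le b(x)\left(|z_1|^\ell+|z_2|^\ell\right)|z_1-z_2|.$$ Suppose that $V\in L^{p_1}_{loc}+L^{p_2}(|x|>1)$ for some $\frac1{2s}<p_1,p_2\le\infty$, that $a,b\in L^{q_1}_{loc}+L^{q_2}(|x|>1)$ for some $1<q_1,q_2\le\infty$, and moreover that $V,b\in L^\infty(\mathbb R)$. For $\varphi\in H^s(\mathbb R)$ and an open interval $I\ni0$, an $H^s$-weak solution on $I$ of $$i\partial_t\Phi+(-\Delta)^s\Phi=V(x)\Phi+f(x,\Phi),\qquad \Phi(0)=\varphi,$$ is a function $\Phi\in L^\infty_{loc}(I;H^s(\mathbb R))\cap W^{1,\infty}_{loc}(I;H^{-s}(\mathbb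 R))$, identified with its continuous representative $I\to H^{-s}(\mathbb R)$, that satisfies the equation in $H^{-s}(\mathbb R)$ for almost every $t\in I$ and has $\Phi(0)=\varphi$. Then the $H^s$-weak solution is unique: for every $\varphi\in H^s(\mathbb R)$ and every open interval $I\ni0$, if $\Phi$ and $\Psi$ are $H^s$-weak solutions on $I$ with the same initial datum $\varphi$, then $\Phi(t)=\Psi(t)$ for all $t\in I$. -/

import Mathlib

open MeasureTheory TemperedDistribution
open scoped SchwartzMap ENNReal ContDiff FourierTransform

namespace FracNLS

/-- The tempered distribution `u` on `ℝ` is the (locally integrable) function `v`: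
`u ψ = ∫ v ψ` for all Schwartz functions `ψ`, with absolutely convergent integrals. -/
def Represents (v : ℝ → ℂ) (u : 𝓢'(ℝ, ℂ)) : Prop :=
  ∀ ψ : 𝓢(ℝ, ℂ), Integrable (fun x => v x * ψ x) volume ∧ u ψ = ∫ x, v x * ψ x

/-- `w = (-Δ)^s u`: the Fourier transform of `u` is a function `v`, and that of `w` is
`(2π|ξ|)^{2s} v(ξ)`. (Mathlib's Fourier transform has the kernel `exp (-2πi x ξ)`, so that `-Δ` has
the symbol `(2π|ξ|)²`.) -/
def IsFracLaplacian (s : ℝ) (u w : 𝓢'(ℝ, ℂ)) : Prop :=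
  ∃ v : ℝ → ℂ, Represents v (𝓕 u) ∧
    Represents (fun ξ => (((2 * Real.pi * |ξ|) ^ (2 * s) : ℝ) : ℂ) * v ξ) (𝓕 w)

/-- `w = N(·, u)`: the distribution `u` is a function `v`, and `w` is the function
`x ↦ N(x, v(x))`. -/
def IsNonlinearity (N : ℝ → ℂ → ℂ) (u w : 𝓢'(ℝ, ℂ)) : Prop :=
  ∃ v : ℝ → ℂ, Represents v u ∧ Represents (fun x => N x (v x)) w

/-- `Φ ∈ L^∞_loc(I; H^σ(ℝ))`. The Bessel potential of order `σ` identifies `H^σ` with `L²`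
isometrically, so this says that the `L²`-valued function `g(t) = ⟨D⟩^σ Φ(t)` is strongly
measurable and essentially bounded on each compact subset of `I`. -/
def MemLinftyLocSobolev (σ : ℝ) (I : Set ℝ) (Φ : ℝ → 𝓢'(ℝ, ℂ)) : Prop :=
  ∃ g : ℝ → Lp ℂ 2 (volume : Measure ℝ),
    (∀ᵐ t ∂(volume.restrict I), besselPotential ℝ ℂ σ (Φ t) = (g t : 𝓢'(ℝ, ℂ))) ∧
    ∀ K : Set ℝ, K ⊆ I → IsCompact K → MemLp g ∞ (volume.restrict K)

/-- `Φ ∈ C(I; H^σ(ℝ))`. -/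
def ContinuousOnSobolev (σ : ℝ) (I : Set ℝ) (Φ : ℝ → 𝓢'(ℝ, ℂ)) : Prop :=
  ∃ g : ℝ → Lp ℂ 2 (volume : Measure ℝ),
    (∀ t ∈ I, besselPotential ℝ ℂ σ (Φ t) = (g t : 𝓢'(ℝ, ℂ))) ∧ ContinuousOn g I

/-- `Φ' = ∂ₜ Φ` on `I` in the weak sense, tested with `η ∈ C_c^∞(I)` in time and Schwartz functions
in space. -/
def HasWeakTimeDeriv (I : Set ℝ) (Φ Φ' : ℝ → 𝓢'(ℝ, ℂ)) : Prop :=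
  ∀ η : ℝ → ℝ, ContDiff ℝ ∞ η → HasCompactSupport η → tsupport η ⊆ I →
    ∀ ψ : 𝓢(ℝ, ℂ), ∫ t, ((deriv η t : ℝ) : ℂ) * Φ t ψ = -∫ t, ((η t : ℝ) : ℂ) * Φ' t ψ

/-- `Φ` is an `H^s`-weak solution on the open time interval `I ∋ 0` of
`i ∂ₜ Φ + (-Δ)^s Φ = N(x, Φ)`, `Φ(0) = φ`: it lies in
`L^∞_loc(I; H^s) ∩ W^{1,∞}_loc(I; H^{-s})`, and the equation holds in `H^{-s}` for almost every
`t ∈ I`. An element of `W^{1,∞}_loc(I; H^{-s})` is identified with its continuous representative,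
which gives a meaning to its value at each time. -/
structure IsWeakSolution (s : ℝ) (N : ℝ → ℂ → ℂ) (φ : 𝓢'(ℝ, ℂ)) (I : Set ℝ)
    (Φ : ℝ → 𝓢'(ℝ, ℂ)) : Prop where
  mem_Linfty : MemLinftyLocSobolev s I Φ
  continuousOn : ContinuousOnSobolev (-s) I Φ
  equation : ∃ Φ' : ℝ → 𝓢'(ℝ, ℂ), MemLinftyLocSobolev (-s) I Φ' ∧ HasWeakTimeDeriv I Φ Φ' ∧
    ∀ᵐ t ∂(volume.restrict I), ∃ A B : 𝓢'(ℝ, ℂ),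
      IsFracLaplacian s (Φ t) A ∧ IsNonlinearity N (Φ t) B ∧ Complex.I • Φ' t + A = B
  initial : Φ 0 = φ

/-- `g ∈ L^{p₁}_loc(ℝ) + L^{p₂}(|x| > 1)`, where functions on `{|x| > 1}` are extended by zero. -/
def MemLlocAddLp (p₁ p₂ : ℝ≥0∞) (g : ℝ → ℝ) : Prop :=
  ∃ g₁ g₂ : ℝ → ℝ, (∀ x, g x = g₁ x + {y : ℝ | 1 < |y|}.indicator g₂ x) ∧
    (∀ K : Set ℝ, IsCompact K → MemLp g₁ p₁ (volume.restrict K)) ∧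
    MemLp g₂ p₂ (volume.restrict {y : ℝ | 1 < |y|})

end FracNLS

/-!
Uniqueness is an energy estimate in `L²`. Since `s > 1/2`, solutions that are locally bounded in time
with values in `H^s` are bounded functions (`exists_sobolev_embedding`). As `V` and `b` are bounded,
the difference of the right-hand sides of two solutions `Φ`, `Ψ` is therefore controlled by `Φ - Ψ`
in `L²`, locally uniformly in time (`exists_nonlinearity_sub`). Formally, `(-Δ)^s` being
self-adjoint, `d/dt ‖Φ - Ψ‖² ≤ 2 M ‖Φ - Ψ‖²`, and Grönwall's lemma gives `Φ = Ψ`.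

The time derivative of a solution lies only in `H^{-s}`. The computation is therefore made on the
Fourier side, where the equation is an identity of functions of `ξ` for almost every time
(`exists_frequency_equation`), and with the frequencies truncated to `|ξ| ≤ n`. The Bessel potential
of order `-s` of a solution is the `L²`-valued primitive of that of its weak time derivative
(`HasWeakTimeDeriv.sub_eq_integral`), and truncated multiplication by `(1 + |ξ|²)^{s/2}` is bounded on
`L²`. So the truncated difference is a primitive of a bounded function, the energy identity
`norm_sq_integral_eq` holds for it, and the symbol `(2π|ξ|)^{2s}`, however large, drops out of it,
because it is real (`abs_inner_cutoffMul_le`). The bounds do not depend on `n`, and `n → ∞` gives an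
integral inequality to which Grönwall's lemma applies (`eq_zero_of_energy`).
-/

namespace FracNLS

open Set Filter Topology

/-! ### Essentially bounded functions -/

theorem ae_norm_le_eLpNorm_top {α E : Type*} [MeasurableSpace α] [NormedAddCommGroup E]
    {μ : Measure α} {g : α → E} (hg : MemLp g ∞ μ) :
    ∀ᵐ t ∂μ, ‖g t‖ ≤ (eLpNorm g ∞ μ).toReal := by
  filter_upwards [ae_le_eLpNormEssSup (f := g) (μ := μ)] with t ht
  rw [← eLpNorm_exponent_top] at ht
  rw [← toReal_enorm]
  exact ENNReal.toReal_mono hg.2.ne ht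

theorem integrableOn_of_memLp_top {E : Type*} [NormedAddCommGroup E] {d : ℝ → E} {K : Set ℝ}
    (hK : IsCompact K) (hd : MemLp d ∞ (volume.restrict K)) : IntegrableOn d K := by
  have : IsFiniteMeasure (volume.restrict K) := ⟨by
    rw [Measure.restrict_apply_univ]; exact hK.measure_lt_top⟩
  exact hd.integrable le_top

/-! ### Grönwall's lemma and the energy identity -/

/-- Grönwall's lemma for an integrable `v ≥ 0` satisfying `v t ≤ M ∫₀ᵗ v` almost everywhere,
forward in time. The primitive `E` of `v` is continuous and satisfies the same inequality, so the
differential form of the lemma applies to the primitive of `E`. -/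
theorem integral_eq_zero_of_le_integral {v : ℝ → ℝ} {T M : ℝ} (hT : 0 ≤ T)
    (hv : IntervalIntegrable v volume 0 T) (hv0 : ∀ t, 0 ≤ v t)
    (h : ∀ᵐ t, t ∈ Ioc 0 T → v t ≤ M * ∫ τ in (0 : ℝ)..t, v τ) :
    ∫ τ in (0 : ℝ)..T, v τ = 0 := by
  set E : ℝ → ℝ := fun t => ∫ τ in (0 : ℝ)..t, v τ with hE
  have hsub : ∀ t ∈ Icc 0 T, IntervalIntegrable v volume 0 t := fun t ht =>
    hv.mono_set (by rw [uIcc_of_le ht.1, uIcc_of_le hT]; exact Icc_subset_Icc_right ht.2)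
  have hEc : ContinuousOn E (Icc 0 T) := by
    have := intervalIntegral.continuousOn_primitive_interval (μ := volume) (f := v) (a := 0) (b := T)
      (by rw [uIcc_of_le hT]; exact (intervalIntegrable_iff_integrableOn_Icc_of_le hT).1 hv)
    rwa [uIcc_of_le hT] at this
  have hE0 : ∀ t ∈ Icc 0 T, 0 ≤ E t := fun t ht =>
    intervalIntegral.integral_nonneg ht.1 (fun u _ => hv0 u)
  have hEint : ∀ t ∈ Icc 0 T, IntervalIntegrable E volume 0 t := fun t ht =>
    (hEc.mono (by rw [uIcc_of_le ht.1]; exact Icc_subset_Icc_right ht.2)).intervalIntegrable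
  have hEle : ∀ t ∈ Icc 0 T, E t ≤ M * ∫ τ in (0 : ℝ)..t, E τ := by
    intro t ht
    rw [← intervalIntegral.integral_const_mul]
    refine intervalIntegral.integral_mono_ae_restrict ht.1 (hsub t ht) ((hEint t ht).const_mul M) ?_
    rw [EventuallyLE, ae_restrict_iff' measurableSet_Icc]
    filter_upwards [h, (by simp [ae_iff] : ∀ᵐ t : ℝ, t ≠ 0)] with u hu hu0 huI
    exact hu ⟨lt_of_le_of_ne huI.1 hu0.symm, huI.2.trans ht.2⟩
  set F : ℝ → ℝ := fun t => ∫ τ in (0 : ℝ)..t, E τ with hF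
  have hF0 : ∀ t ∈ Icc 0 T, 0 ≤ F t := fun t ht =>
    intervalIntegral.integral_nonneg ht.1 (fun u hu => hE0 u ⟨hu.1, hu.2.trans ht.2⟩)
  have hFc : ContinuousOn F (Icc 0 T) := by
    have := intervalIntegral.continuousOn_primitive_interval (μ := volume) (f := E) (a := 0) (b := T)
      (by rw [uIcc_of_le hT]; exact hEc.integrableOn_Icc)
    rwa [uIcc_of_le hT] at this
  have hFd : ∀ t ∈ Ico 0 T, HasDerivWithinAt F (E t) (Ici t) t := by
    intro t ht
    have hnhds : Icc 0 T ∈ 𝓝[>] t := mem_of_superset (Ioo_mem_nhdsGT ht.2)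
      (fun x hx => ⟨ht.1.trans hx.1.le, hx.2.le⟩)
    have hcw : ContinuousWithinAt E (Ioi t) t :=
      (hEc t ⟨ht.1, ht.2.le⟩).mono_of_mem_nhdsWithin hnhds
    refine intervalIntegral.integral_hasDerivWithinAt_right (hEint t ⟨ht.1, ht.2.le⟩) ?_ hcw
    exact (hEc.stronglyMeasurableAtFilter_nhdsWithin measurableSet_Icc t).filter_mono
      (nhdsWithin_le_of_mem hnhds)
  have hFz : ∀ t ∈ Icc 0 T, F t = 0 := by
    intro t ht
    have := norm_le_gronwallBound_of_norm_deriv_right_le (f := F) (f' := E) (δ := 0) (K := M) (ε := 0)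
      (a := 0) (b := T) hFc hFd (by simp [hF]) (fun x hx => by
        have hx' : x ∈ Icc 0 T := ⟨hx.1, hx.2.le⟩
        rw [Real.norm_of_nonneg (hE0 x hx'), Real.norm_of_nonneg (hF0 x hx'), add_zero]
        exact hEle x hx') t ht
    simpa [gronwallBound_ε0_δ0] using this
  have h1 := hEle T ⟨hT, le_rfl⟩
  have h2 := hFz T ⟨hT, le_rfl⟩
  simp only [hF] at h2
  rw [h2, mul_zero] at h1
  exact le_antisymm h1 (hE0 T ⟨hT, le_rfl⟩)

/-- Grönwall's lemma in both directions of time; the backward case follows by reflection. -/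
theorem integral_eq_zero_of_le_abs_integral {v : ℝ → ℝ} {T M : ℝ}
    (hv : IntervalIntegrable v volume 0 T) (hv0 : ∀ t, 0 ≤ v t)
    (h : ∀ᵐ t, t ∈ uIoc 0 T → v t ≤ M * |∫ τ in (0 : ℝ)..t, v τ|) :
    ∫ τ in (0 : ℝ)..T, v τ = 0 := by
  rcases le_total 0 T with hT | hT
  · refine integral_eq_zero_of_le_integral (M := M) hT hv hv0 ?_
    rw [uIoc_of_le hT] at h
    filter_upwards [h] with t ht htI
    have := ht htI
    rwa [abs_of_nonneg (intervalIntegral.integral_nonneg htI.1.le fun u _ => hv0 u)] at this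
  · have key : ∀ t, ∫ τ in (0 : ℝ)..t, v (-τ) = -∫ τ in (0 : ℝ)..(-t), v τ := by
      intro t
      rw [intervalIntegral.integral_comp_neg (fun x => v x), neg_zero,
        intervalIntegral.integral_symm]
    have hv' : IntervalIntegrable (fun τ => v (-τ)) volume 0 (-T) := by
      have := (IntervalIntegrable.iff_comp_neg).1 hv
      simpa using this
    have := integral_eq_zero_of_le_integral (v := fun τ => v (-τ)) (T := -T) (M := M) (by linarith)
      hv' (fun t => hv0 _) (by
        have h' := (Measure.measurePreserving_neg (volume : Measure ℝ)).quasiMeasurePreserving.ae h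
        filter_upwards [h', (by simp [ae_iff] : ∀ᵐ t : ℝ, t ≠ -T)] with t ht htT htI
        rw [uIoc_of_ge hT] at ht
        have := ht ⟨by rcases htI with ⟨_, h2⟩; have := lt_of_le_of_ne h2 htT; linarith,
          by linarith [htI.1]⟩
        rw [key, ← abs_of_nonneg (a := -∫ τ in (0 : ℝ)..(-t), v τ)]
        · rwa [abs_neg]
        · rw [← key]
          exact intervalIntegral.integral_nonneg htI.1.le fun u _ => hv0 _)
    rw [key, neg_neg] at this
    linarith

/-- The energy identity `‖Y T‖² = ∫₀ᵀ 2 ⟪Y, y⟫` for the primitive `Y` of an essentially bounded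
function `y` with values in a Hilbert space: `‖Y‖²` is absolutely continuous, being the square of a
Lipschitz function, and its derivative is found from Lebesgue's differentiation theorem. -/
theorem norm_sq_integral_eq {E : Type*} [NormedAddCommGroup E] [InnerProductSpace ℝ E]
    [CompleteSpace E] {y : ℝ → E} {T C : ℝ} (hy : IntervalIntegrable y volume 0 T)
    (hC : ∀ᵐ t, t ∈ uIoc 0 T → ‖y t‖ ≤ C) :
    ‖∫ τ in (0 : ℝ)..T, y τ‖ ^ 2 =
      ∫ t in (0 : ℝ)..T, 2 * inner ℝ (∫ τ in (0 : ℝ)..t, y τ) (y t) := by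
  set Y : ℝ → E := fun t => ∫ τ in (0 : ℝ)..t, y τ with hY
  have hsub : ∀ a ∈ uIcc 0 T, ∀ b ∈ uIcc 0 T, IntervalIntegrable y volume a b :=
    fun a ha b hb => hy.mono_set (uIcc_subset_uIcc ha hb)
  have hLip : LipschitzOnWith (Real.toNNReal C) Y (uIcc 0 T) := by
    refine LipschitzOnWith.of_dist_le_mul fun a ha b hb => ?_
    rw [dist_eq_norm, hY]
    simp only
    rw [intervalIntegral.integral_interval_sub_left (hsub _ left_mem_uIcc _ ha)
      (hsub _ left_mem_uIcc _ hb), Real.dist_eq]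
    refine intervalIntegral.norm_integral_le_of_norm_le_const_ae ?_
    filter_upwards [hC, (by simp [ae_iff] : ∀ᵐ t : ℝ, t ≠ min 0 T)] with t ht ht0 htI
    have htm : t ∈ uIcc 0 T := uIcc_subset_uIcc hb ha (uIoc_subset_uIcc htI)
    exact (ht ⟨lt_of_le_of_ne htm.1 ht0.symm, htm.2⟩).trans (Real.le_coe_toNNReal C)
  have hAC : AbsolutelyContinuousOnInterval (fun t => ‖Y t‖) 0 T := by
    have : LipschitzOnWith (1 * Real.toNNReal C) (norm ∘ Y) (uIcc 0 T) :=
      lipschitzWith_one_norm.comp_lipschitzOnWith hLip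
    exact this.absolutelyContinuousOnInterval
  have hAC2 : AbsolutelyContinuousOnInterval (fun t => ‖Y t‖ ^ 2) 0 T := by
    have := hAC.mul hAC
    convert this using 2 with t
    simp [sq]
  have := hAC2.integral_deriv_eq_sub
  simp only [hY, intervalIntegral.integral_same, norm_zero] at this
  rw [show (0 : ℝ) ^ 2 = 0 by norm_num, sub_zero] at this
  rw [← this]
  refine intervalIntegral.integral_congr_ae ?_
  filter_upwards [hy.ae_hasDerivAt_integral] with t ht htI
  exact (ht (uIoc_subset_uIcc htI) 0 left_mem_uIcc).norm_sq.deriv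

/-! ### Weak derivatives in time -/

theorem deriv_smoothTransition_eq_zero {u : ℝ} (hu : u ∉ Icc (0 : ℝ) 1) :
    deriv Real.smoothTransition u = 0 := by
  rw [mem_Icc, not_and_or, not_le, not_le] at hu
  rcases hu with hu | hu
  · have : Real.smoothTransition =ᶠ[𝓝 u] fun _ => 0 := by
      filter_upwards [Iio_mem_nhds hu] with x hx
      exact Real.smoothTransition.zero_of_nonpos (le_of_lt hx)
    rw [this.deriv_eq, deriv_const]
  · have : Real.smoothTransition =ᶠ[𝓝 u] fun _ => 1 := by
      filter_upwards [Ioi_mem_nhds hu] with x hx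
      exact Real.smoothTransition.one_of_one_le (le_of_lt hx)
    rw [this.deriv_eq, deriv_const]

theorem contDiff_step (n a : ℝ) : ContDiff ℝ ∞ fun t => Real.smoothTransition (n * (t - a)) :=
  Real.smoothTransition.contDiff.comp (by fun_prop)

theorem deriv_step (n a t : ℝ) :
    deriv (fun t => Real.smoothTransition (n * (t - a))) t =
      n * deriv Real.smoothTransition (n * (t - a)) := by
  have h1 : HasDerivAt (fun t => n * (t - a)) n t := by
    simpa using ((hasDerivAt_id t).sub_const a).const_mul n
  have h2 : HasDerivAt Real.smoothTransition (deriv Real.smoothTransition (n * (t - a)))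
      (n * (t - a)) :=
    ((Real.smoothTransition.contDiff (n := 1)).differentiable (by norm_num) _).hasDerivAt
  have h3 : HasDerivAt (fun t => Real.smoothTransition (n * (t - a)))
      (deriv Real.smoothTransition (n * (t - a)) * n) t :=
    HasDerivAt.comp (h₂ := Real.smoothTransition) t h2 h1
  rw [h3.deriv, mul_comm]

section WeakDeriv

variable {E : Type*} [NormedAddCommGroup E] [NormedSpace ℝ E]

theorem integrable_deriv_step_smul {c : ℝ → E} {a δ n : ℝ} (hn : 0 < n) (hδ : n⁻¹ ≤ δ)
    (hc : ContinuousOn c (Icc a (a + δ))) :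
    Integrable fun t => deriv (fun t => Real.smoothTransition (n * (t - a))) t • c t := by
  have hsupp : ∀ t, t ∉ Icc a (a + δ) →
      deriv (fun t => Real.smoothTransition (n * (t - a))) t • c t = 0 := by
    intro t ht
    rw [deriv_step, deriv_smoothTransition_eq_zero, mul_zero, zero_smul]
    intro h
    refine ht ⟨?_, ?_⟩
    · have := (mul_nonneg_iff_of_pos_left hn).1 h.1
      linarith
    · have h2 : t - a ≤ n⁻¹ := by
        rw [← one_div, le_div_iff₀ hn, mul_comm]; exact h.2
      linarith
  have hI : IntegrableOn (fun t => deriv (fun t => Real.smoothTransition (n * (t - a))) t • c t)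
      (Icc a (a + δ)) := by
    refine ContinuousOn.integrableOn_Icc (ContinuousOn.smul ?_ hc)
    exact ((contDiff_step n a).continuous_deriv (by simp)).continuousOn
  exact hI.integrable_of_forall_notMem_eq_zero hsupp

variable [CompleteSpace E]

/-- With `S = Real.smoothTransition`, the derivatives of the smooth steps `t ↦ S (n (t - a))` form an
approximate identity concentrated to the right of `a`. -/
theorem tendsto_integral_deriv_step_smul {c : ℝ → E} {a δ : ℝ} (hδ : 0 < δ)
    (hc : ContinuousOn c (Icc a (a + δ))) :
    Tendsto (fun n : ℕ => ∫ t, deriv (fun t => Real.smoothTransition (n * (t - a))) t • c t)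
      atTop (𝓝 (c a)) := by
  have hSc : Continuous (deriv Real.smoothTransition) :=
    (Real.smoothTransition.contDiff (n := 1)).continuous_deriv le_rfl
  have hlim : Tendsto (fun n : ℕ => ∫ u in (0 : ℝ)..1,
      deriv Real.smoothTransition u • c (a + (n : ℝ)⁻¹ * u)) atTop
      (𝓝 (∫ u in (0 : ℝ)..1, deriv Real.smoothTransition u • c a)) := by
    obtain ⟨C, hC⟩ := isCompact_Icc.exists_bound_of_continuousOn hc
    have hev : ∀ᶠ n : ℕ in atTop, (n : ℝ)⁻¹ < δ :=
      tendsto_inv_atTop_nhds_zero_nat.eventually (gt_mem_nhds hδ)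
    have hmem : ∀ n : ℕ, (n : ℝ)⁻¹ < δ → ∀ u ∈ Icc (0 : ℝ) 1, a + (n : ℝ)⁻¹ * u ∈ Icc a (a + δ) := by
      intro n hn u hu
      have h0 : (0 : ℝ) ≤ (n : ℝ)⁻¹ := by positivity
      exact ⟨by nlinarith [hu.1, mul_nonneg h0 hu.1], by nlinarith [hu.1, hu.2]⟩
    refine intervalIntegral.tendsto_integral_filter_of_dominated_convergence
      (fun u => ‖deriv Real.smoothTransition u‖ * C) ?_ ?_ ?_ ?_
    · filter_upwards [hev] with n hn
      rw [uIoc_of_le zero_le_one]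
      refine ContinuousOn.aestronglyMeasurable ?_ measurableSet_Ioc
      refine hSc.continuousOn.smul (hc.comp (by fun_prop) fun u hu => hmem n hn u ⟨hu.1.le, hu.2⟩)
    · filter_upwards [hev] with n hn
      refine ae_of_all _ fun u hu => ?_
      rw [uIoc_of_le zero_le_one] at hu
      rw [norm_smul]
      exact mul_le_mul_of_nonneg_left (hC _ (hmem n hn u ⟨hu.1.le, hu.2⟩)) (norm_nonneg _)
    · exact (hSc.norm.mul continuous_const).intervalIntegrable _ _
    · refine ae_of_all _ fun u hu => ?_
      rw [uIoc_of_le zero_le_one] at hu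
      refine Tendsto.const_smul ?_ _
      refine (hc a ⟨le_rfl, by linarith⟩).tendsto.comp ?_
      refine tendsto_nhdsWithin_iff.2 ⟨?_, ?_⟩
      · simpa using (tendsto_inv_atTop_nhds_zero_nat (𝕜 := ℝ)).mul_const u |>.const_add a
      · filter_upwards [hev] with n hn using hmem n hn u ⟨hu.1.le, hu.2⟩
  -- The limit is `c a`, because the smooth step rises from `0` to `1` on `[0, 1]`.
  rw [intervalIntegral.integral_smul_const, intervalIntegral.integral_deriv_eq_sub
    (fun x _ => (Real.smoothTransition.contDiff (n := 1)).differentiable (by norm_num) x)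
    (hSc.intervalIntegrable _ _), Real.smoothTransition.one, Real.smoothTransition.zero, sub_zero,
    one_smul] at hlim
  refine hlim.congr' ?_
  filter_upwards [eventually_gt_atTop 0] with n hn
  have hn' : (0 : ℝ) < n := by exact_mod_cast hn
  rw [intervalIntegral.integral_of_le zero_le_one, ← integral_Icc_eq_integral_Ioc,
    setIntegral_eq_integral_of_forall_compl_eq_zero
      (fun u hu => by rw [deriv_smoothTransition_eq_zero hu, zero_smul])]
  -- Substitute `u = n (t - a)`.
  have h1 := Measure.integral_comp_mul_left
    (fun u => deriv Real.smoothTransition u • c (a + (n : ℝ)⁻¹ * u)) (n : ℝ)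
  have h2 := integral_sub_right_eq_self (μ := volume) (fun t : ℝ =>
    deriv Real.smoothTransition (n * t) • c (a + (n : ℝ)⁻¹ * (n * t))) a
  rw [h1] at h2
  simp only [deriv_step, mul_smul]
  rw [integral_smul]
  have h3 : ∀ t : ℝ, a + (n : ℝ)⁻¹ * (n * (t - a)) = t := by
    intro t; field_simp; ring
  simp only [h3] at h2
  rw [h2, smul_smul, abs_of_pos (by positivity), mul_inv_cancel₀ hn'.ne', one_smul]

theorem tendsto_step (a t : ℝ) :
    Tendsto (fun n : ℕ => Real.smoothTransition (n * (t - a))) atTop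
      (𝓝 (if a < t then 1 else 0)) := by
  split_ifs with h
  · have : Tendsto (fun n : ℕ => (n : ℝ) * (t - a)) atTop atTop :=
      tendsto_natCast_atTop_atTop.atTop_mul_const (by linarith)
    refine tendsto_const_nhds.congr' ?_
    filter_upwards [this.eventually_ge_atTop 1] with n hn
    exact (Real.smoothTransition.one_of_one_le hn).symm
  · refine tendsto_const_nhds.congr' (Eventually.of_forall fun n => ?_)
    exact (Real.smoothTransition.zero_of_nonpos
      (mul_nonpos_of_nonneg_of_nonpos (by positivity) (by linarith))).symm

/-- The fundamental theorem of calculus for weak derivatives, for `a < b`. The test functions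
`S (n (t - a)) - S (n (t - b))`, where `S = Real.smoothTransition`, tend to the indicator function
of `(a, b]`, while their derivatives tend to the difference of the Dirac measures at `a` and `b`. -/
theorem sub_eq_integral_of_weakDeriv_of_lt {I : Set ℝ} (hI : IsOpen I) (hconn : I.OrdConnected)
    {c d : ℝ → E} (hc : ContinuousOn c I)
    (hd : ∀ K ⊆ I, IsCompact K → IntegrableOn d K)
    (h : ∀ η : ℝ → ℝ, ContDiff ℝ ∞ η → HasCompactSupport η → tsupport η ⊆ I →
      ∫ t, deriv η t • c t = -∫ t, η t • d t)
    {a b : ℝ} (ha : a ∈ I) (hb : b ∈ I) (hab : a < b) : c b - c a = ∫ t in a..b, d t := by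
  obtain ⟨δ, hδ, hδI⟩ : ∃ δ > 0, Icc a (b + δ) ⊆ I := by
    obtain ⟨ε, hε, hball⟩ := Metric.isOpen_iff.1 hI b hb
    refine ⟨ε / 2, by positivity, hconn.out ha (hball ?_)⟩
    rw [Metric.mem_ball, Real.dist_eq, add_sub_cancel_left, abs_of_pos (by positivity)]
    linarith
  have hev : ∀ᶠ n : ℕ in atTop, (n : ℝ)⁻¹ < δ :=
    tendsto_inv_atTop_nhds_zero_nat.eventually (gt_mem_nhds hδ)
  have hca : ContinuousOn c (Icc a (a + δ)) :=
    hc.mono ((Icc_subset_Icc_right (by linarith)).trans hδI)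
  have hcb : ContinuousOn c (Icc b (b + δ)) :=
    hc.mono ((Icc_subset_Icc_left hab.le).trans hδI)
  set η : ℕ → ℝ → ℝ := fun n t =>
    Real.smoothTransition (n * (t - a)) - Real.smoothTransition (n * (t - b)) with hη
  have hzero : ∀ n : ℕ, 0 < n → (n : ℝ)⁻¹ < δ → ∀ t, t ∉ Icc a (b + δ) → η n t = 0 := by
    intro n hn0 hn t ht
    have hn' : (0 : ℝ) < n := by exact_mod_cast hn0
    rw [mem_Icc, not_and_or, not_le, not_le] at ht
    simp only [hη]
    rcases ht with ht | ht
    · rw [Real.smoothTransition.zero_of_nonpos, Real.smoothTransition.zero_of_nonpos, sub_zero]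
      · exact mul_nonpos_of_nonneg_of_nonpos hn'.le (by linarith)
      · exact mul_nonpos_of_nonneg_of_nonpos hn'.le (by linarith)
    · have h1 : 1 ≤ n * (t - b) := by
        rw [← div_le_iff₀' hn', one_div]; linarith
      rw [Real.smoothTransition.one_of_one_le h1, Real.smoothTransition.one_of_one_le, sub_self]
      nlinarith
  have hlim1 : Tendsto (fun n : ℕ => ∫ t, deriv (η n) t • c t) atTop (𝓝 (c a - c b)) := by
    refine ((tendsto_integral_deriv_step_smul hδ hca).sub
      (tendsto_integral_deriv_step_smul hδ hcb)).congr' ?_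
    filter_upwards [hev, eventually_gt_atTop 0] with n hn hn0
    have hn' : (0 : ℝ) < n := by exact_mod_cast hn0
    rw [← integral_sub (integrable_deriv_step_smul hn' hn.le hca)
      (integrable_deriv_step_smul hn' hn.le hcb)]
    refine integral_congr_ae (ae_of_all _ fun t => ?_)
    simp only [hη]
    rw [deriv_fun_sub ((contDiff_step n a).differentiable (by simp) t)
      ((contDiff_step n b).differentiable (by simp) t), sub_smul]
  have hlim2 : Tendsto (fun n : ℕ => ∫ t, η n t • d t) atTop (𝓝 (∫ t in a..b, d t)) := by
    rw [intervalIntegral.integral_of_le hab.le, ← integral_indicator measurableSet_Ioc]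
    have hdI := (hd _ hδI isCompact_Icc)
    have hdI' := hdI.integrable_indicator measurableSet_Icc
    have hab1 : ∀ x, |Real.smoothTransition x| ≤ 1 := fun x => by
      rw [abs_of_nonneg (Real.smoothTransition.nonneg x)]; exact Real.smoothTransition.le_one x
    have heq : ∀ n : ℕ, 0 < n → (n : ℝ)⁻¹ < δ →
        (fun t => η n t • d t) = fun t => η n t • (Icc a (b + δ)).indicator d t := by
      intro n hn0 hn
      ext t
      by_cases ht : t ∈ Icc a (b + δ)
      · rw [indicator_of_mem ht]
      · rw [hzero n hn0 hn t ht, zero_smul, zero_smul]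
    have hηc : ∀ n, Continuous (η n) := fun n =>
      ((contDiff_step n a).continuous).sub ((contDiff_step n b).continuous)
    refine tendsto_integral_filter_of_dominated_convergence
      (fun t => 2 * ‖(Icc a (b + δ)).indicator d t‖) ?_ ?_ (hdI'.norm.const_mul 2) ?_
    · filter_upwards [hev, eventually_gt_atTop 0] with n hn hn0
      rw [heq n hn0 hn]
      exact (hηc n).aestronglyMeasurable.smul hdI'.aestronglyMeasurable
    · filter_upwards [hev, eventually_gt_atTop 0] with n hn hn0
      refine ae_of_all _ fun t => ?_
      rw [congrFun (heq n hn0 hn) t, norm_smul]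
      refine mul_le_mul_of_nonneg_right ?_ (norm_nonneg _)
      rw [Real.norm_eq_abs]
      refine (abs_sub _ _).trans ?_
      linarith [hab1 (n * (t - a)), hab1 (n * (t - b))]
    · refine ae_of_all _ fun t => ?_
      have := ((tendsto_step a t).sub (tendsto_step b t)).smul_const (d t)
      convert this using 2
      by_cases h1 : a < t <;> by_cases h2 : b < t
      · simp [h1, h2, indicator]
      · simp [h1, h2, indicator, not_lt.1 h2]
      · linarith
      · simp [h1, indicator, h2]
  have hlim3 : Tendsto (fun n : ℕ => -∫ t, η n t • d t) atTop (𝓝 (c a - c b)) := by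
    refine hlim1.congr' ?_
    filter_upwards [hev, eventually_gt_atTop 0] with n hn hn0
    have hts : tsupport (η n) ⊆ Icc a (b + δ) := by
      refine closure_minimal (fun t ht => ?_) isClosed_Icc
      by_contra hcon
      exact ht (hzero n hn0 hn t hcon)
    exact h (η n) ((contDiff_step n a).sub (contDiff_step n b))
      (isCompact_Icc.of_isClosed_subset (isClosed_tsupport _) hts) (hts.trans hδI)
  have := tendsto_nhds_unique hlim3 hlim2.neg
  rw [← neg_sub, this, neg_neg]

/-- If `c` is continuous on an open interval and has the locally integrable weak derivative `d`,
then `c` is a primitive of `d`. -/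
theorem sub_eq_integral_of_weakDeriv {I : Set ℝ} (hI : IsOpen I) (hconn : I.OrdConnected)
    {c d : ℝ → E} (hc : ContinuousOn c I)
    (hd : ∀ K ⊆ I, IsCompact K → IntegrableOn d K)
    (h : ∀ η : ℝ → ℝ, ContDiff ℝ ∞ η → HasCompactSupport η → tsupport η ⊆ I →
      ∫ t, deriv η t • c t = -∫ t, η t • d t)
    {a b : ℝ} (ha : a ∈ I) (hb : b ∈ I) : c b - c a = ∫ t in a..b, d t := by
  rcases lt_trichotomy a b with hab | rfl | hab
  · exact sub_eq_integral_of_weakDeriv_of_lt hI hconn hc hd h ha hb hab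
  · simp
  · rw [intervalIntegral.integral_symm,
      ← sub_eq_integral_of_weakDeriv_of_lt hI hconn hc hd h hb ha hab, neg_sub]

end WeakDeriv

/-! ### The energy estimate at truncated frequencies -/

/-- Multiplication by an essentially bounded function, as a bounded operator on `L²(ℝ)`. -/
noncomputable def mulL2 (k : Lp ℂ ∞ (volume : Measure ℝ)) :
    Lp ℂ 2 (volume : Measure ℝ) →L[ℂ] Lp ℂ 2 (volume : Measure ℝ) :=
  (ContinuousLinearMap.mul ℂ ℂ).holderL volume ∞ 2 2 k

theorem coeFn_mulL2 (k : Lp ℂ ∞ (volume : Measure ℝ)) (f : Lp ℂ 2 (volume : Measure ℝ)) :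
    mulL2 k f =ᵐ[volume] fun x => k x * f x :=
  (ContinuousLinearMap.mul ℂ ℂ).coeFn_holder k f

theorem memLp_top_indicator_ofReal {κ : ℝ → ℝ} (hκ : Continuous κ) (n : ℕ) :
    MemLp ((Icc (-(n : ℝ)) n).indicator fun ξ => (κ ξ : ℂ)) ∞ volume := by
  obtain ⟨C, hC⟩ := isCompact_Icc.exists_bound_of_continuousOn
    (hκ.continuousOn (s := Icc (-(n : ℝ)) n))
  refine memLp_top_of_bound (C := max C 0) ?_ (ae_of_all _ fun x => ?_)
  · exact ((Complex.continuous_ofReal.comp hκ).aestronglyMeasurable).indicator measurableSet_Icc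
  · by_cases hx : x ∈ Icc (-(n : ℝ)) n
    · rw [indicator_of_mem hx, Complex.norm_real]
      exact (hC x hx).trans (le_max_left _ _)
    · rw [indicator_of_notMem hx, norm_zero]
      exact le_max_right _ _

/-- Multiplication by the continuous symbol `κ`, truncated to the frequencies `|ξ| ≤ n` so as to be a
bounded operator on `L²(ℝ)`. -/
noncomputable def cutoffMul {κ : ℝ → ℝ} (hκ : Continuous κ) (n : ℕ) :
    Lp ℂ 2 (volume : Measure ℝ) →L[ℂ] Lp ℂ 2 (volume : Measure ℝ) :=
  mulL2 ((memLp_top_indicator_ofReal hκ n).toLp _)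

theorem coeFn_cutoffMul {κ : ℝ → ℝ} (hκ : Continuous κ) (n : ℕ)
    (f : Lp ℂ 2 (volume : Measure ℝ)) :
    cutoffMul hκ n f =ᵐ[volume] (Icc (-(n : ℝ)) n).indicator fun ξ => (κ ξ : ℂ) * f ξ := by
  filter_upwards [coeFn_mulL2 ((memLp_top_indicator_ofReal hκ n).toLp _) f,
    (memLp_top_indicator_ofReal hκ n).coeFn_toLp] with ξ h1 h2
  rw [cutoffMul, h1, h2]
  by_cases hξ : ξ ∈ Icc (-(n : ℝ)) n
  · simp only [indicator_of_mem hξ]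
  · simp only [indicator_of_notMem hξ, zero_mul]

theorem exists_nat_mem_Icc (ξ : ℝ) : ∃ N : ℕ, ∀ n ≥ N, ξ ∈ Icc (-(n : ℝ)) n := by
  obtain ⟨N, hN⟩ := exists_nat_ge |ξ|
  refine ⟨N, fun n hn => abs_le.1 (hN.trans (by exact_mod_cast hn))⟩

/-- A bound on all truncations of `κ w` passes to `κ w` itself, by Fatou's lemma. -/
theorem norm_le_of_cutoffMul {κ : ℝ → ℝ} (hκ : Continuous κ)
    {h w : Lp ℂ 2 (volume : Measure ℝ)} (hw : h =ᵐ[volume] fun ξ => (κ ξ : ℂ) * w ξ) {C : ℝ}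
    (hC : ∀ n, ‖cutoffMul hκ n w‖ ≤ C) : ‖h‖ ≤ C := by
  have hC0 : 0 ≤ C := (norm_nonneg _).trans (hC 0)
  have hlim : ∀ᵐ ξ, Tendsto (fun n : ℕ => cutoffMul hκ n w ξ) atTop (𝓝 (h ξ)) := by
    filter_upwards [hw, ae_all_iff.2 fun n => coeFn_cutoffMul hκ n w] with ξ h1 h2
    obtain ⟨N, hN⟩ := exists_nat_mem_Icc ξ
    refine tendsto_const_nhds.congr' ?_
    filter_upwards [eventually_ge_atTop N] with n hn
    rw [h2, indicator_of_mem (hN n hn), h1]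
  have := Lp.eLpNorm_lim_le_liminf_eLpNorm (p := 2)
    (fun n => (Lp.aestronglyMeasurable (cutoffMul hκ n w))) h hlim
  have h2 : eLpNorm h 2 volume ≤ ENNReal.ofReal C := by
    refine this.trans ?_
    refine (liminf_le_liminf (v := fun _ => ENNReal.ofReal C)
      (Eventually.of_forall fun n => ?_)).trans (by simp)
    have := hC n
    rw [Lp.norm_def] at this
    exact (ENNReal.le_ofReal_iff_toReal_le (Lp.eLpNorm_ne_top _) hC0).2 this
  rw [Lp.norm_def]
  exact ENNReal.toReal_le_of_le_ofReal hC0 h2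

theorem eq_zero_of_cutoffMul_eq_zero {κ : ℝ → ℝ} (hκ : Continuous κ) (hκ0 : ∀ ξ, κ ξ ≠ 0)
    {w : Lp ℂ 2 (volume : Measure ℝ)} (h : ∀ n, cutoffMul hκ n w = 0) : w = 0 := by
  rw [Lp.eq_zero_iff_ae_eq_zero]
  filter_upwards [ae_all_iff.2 fun n => coeFn_cutoffMul hκ n w,
    Lp.coeFn_zero ℂ 2 (volume : Measure ℝ)] with ξ h2 h3
  obtain ⟨N, hN⟩ := exists_nat_mem_Icc ξ
  have := h2 N
  rw [h N, h3, indicator_of_mem (hN N le_rfl)] at this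
  simpa [hκ0 ξ] using this.symm

/-- If `i κ d + m κ w = F` with a real symbol `m`, then the term with `m` does not contribute to the
real inner product of `κ w` and `κ d`, at whatever frequency they are truncated: multiplication by
`i m` is skew-adjoint. -/
theorem abs_inner_cutoffMul_le {κ m : ℝ → ℝ} (hκ : Continuous κ) (n : ℕ)
    {w d h F : Lp ℂ 2 (volume : Measure ℝ)} (hw : h =ᵐ[volume] fun ξ => (κ ξ : ℂ) * w ξ)
    (hF : ∀ᵐ ξ, Complex.I * ((κ ξ : ℂ) * d ξ) + (m ξ : ℂ) * h ξ = F ξ) :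
    |inner ℝ (cutoffMul hκ n w) (cutoffMul hκ n d)| ≤ ‖h‖ * ‖F‖ := by
  have h1 : inner ℝ (cutoffMul hκ n w) (cutoffMul hκ n d) =
      inner ℝ (cutoffMul hκ n w) ((-Complex.I) • F) := by
    rw [L2.inner_def, L2.inner_def]
    refine integral_congr_ae ?_
    filter_upwards [hw, hF, coeFn_cutoffMul hκ n w, coeFn_cutoffMul hκ n d,
      Lp.coeFn_smul (-Complex.I) F] with ξ h1 h2 h3 h4 h5
    rw [h3, h4, h5]
    by_cases hξ : ξ ∈ Icc (-(n : ℝ)) n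
    · rw [indicator_of_mem hξ, indicator_of_mem hξ, ← h1, Pi.smul_apply, smul_eq_mul, ← h2]
      have : (κ ξ : ℂ) * d ξ = -Complex.I * (Complex.I * ((κ ξ : ℂ) * d ξ)) := by
        rw [← mul_assoc, neg_mul, Complex.I_mul_I]; simp
      rw [mul_add, ← this, Complex.inner, Complex.inner]
      simp only [Complex.add_re, Complex.mul_re, Complex.mul_im, Complex.neg_re,
        Complex.neg_im, Complex.I_re, Complex.I_im, Complex.ofReal_re, Complex.ofReal_im,
        Complex.conj_re, Complex.conj_im, Complex.add_im]
      ring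
    · rw [indicator_of_notMem hξ]
      simp
  rw [h1]
  refine (abs_real_inner_le_norm _ _).trans ?_
  rw [norm_smul, norm_neg, Complex.norm_I, one_mul]
  refine mul_le_mul_of_nonneg_right (Lp.norm_le_norm_of_ae_le ?_) (norm_nonneg _)
  filter_upwards [hw, coeFn_cutoffMul hκ n w] with ξ h1 h3
  rw [h3, h1]
  exact norm_indicator_le_norm_self _ _

/-- Uniqueness for the equation `i ∂ₜ (κ W) + m κ W = F` on the Fourier side with `W 0 = 0`, where
`m` is real and `F` is controlled by `h = κ W` in `L²` at almost every time. Since `κ ∂ₜ W` need not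
lie in `L²`, the energy identity is applied to the truncations of `κ W`, and the truncation is
removed from the resulting integral inequality before Grönwall's lemma is used. -/
theorem eq_zero_of_energy {κ m : ℝ → ℝ} (hκ : Continuous κ) (hκ0 : ∀ ξ, κ ξ ≠ 0)
    {I : Set ℝ} (hconn : I.OrdConnected) (h0 : 0 ∈ I)
    {W D h : ℝ → Lp ℂ 2 (volume : Measure ℝ)}
    (hD : ∀ K ⊆ I, IsCompact K → MemLp D ∞ (volume.restrict K))
    (hh : ∀ K ⊆ I, IsCompact K → MemLp h ∞ (volume.restrict K))
    (hW : ∀ t ∈ I, W t = ∫ τ in (0 : ℝ)..t, D τ)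
    (heq : ∀ K ⊆ I, IsCompact K → ∃ M : ℝ, 0 ≤ M ∧ ∀ᵐ t ∂(volume.restrict K),
      (h t =ᵐ[volume] fun ξ => (κ ξ : ℂ) * W t ξ) ∧
      ∃ F : Lp ℂ 2 (volume : Measure ℝ), ‖F‖ ≤ M * ‖h t‖ ∧
        ∀ᵐ ξ, Complex.I * ((κ ξ : ℂ) * D t ξ) + (m ξ : ℂ) * h t ξ = F ξ) :
    ∀ t ∈ I, W t = 0 := by
  intro T hT
  have hK : uIcc 0 T ⊆ I := hconn.uIcc_subset h0 hT
  obtain ⟨M, hM0, hM⟩ := heq _ hK isCompact_uIcc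
  rw [ae_restrict_iff' measurableSet_uIcc] at hM
  have hDint : ∀ t ∈ uIcc 0 T, IntervalIntegrable D volume 0 t := fun t ht => by
    have h1 := (uIcc_subset_uIcc left_mem_uIcc ht).trans hK
    exact (integrableOn_of_memLp_top isCompact_uIcc (hD _ h1 isCompact_uIcc)).intervalIntegrable
  have hvT : IntervalIntegrable (fun t => ‖h t‖ ^ 2) volume 0 T := by
    have : IsFiniteMeasure (volume.restrict (uIcc 0 T)) := by unfold uIcc; infer_instance
    have h1 : MemLp h 2 (volume.restrict (uIcc 0 T)) := (hh _ hK isCompact_uIcc).mono_exponent le_top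
    have h2 : IntegrableOn (fun t => ‖h t‖ ^ 2) (uIcc 0 T) := h1.integrable_norm_pow (by norm_num)
    exact h2.intervalIntegrable
  have hbound : ∀ n : ℕ, ∀ t ∈ uIcc 0 T,
      ‖cutoffMul hκ n (W t)‖ ^ 2 ≤ 2 * M * |∫ τ in (0 : ℝ)..t, ‖h τ‖ ^ 2| := by
    intro n t ht
    have hcomm : ∀ r ∈ uIcc 0 T,
        cutoffMul hκ n (W r) = ∫ τ in (0 : ℝ)..r, cutoffMul hκ n (D τ) := by
      intro r hr
      rw [hW r (hK hr)]
      exact ((cutoffMul hκ n).intervalIntegral_comp_comm (hDint r hr)).symm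
    have hsub : uIcc 0 t ⊆ uIcc 0 T := uIcc_subset_uIcc left_mem_uIcc ht
    have hbd : ∃ C, ∀ᵐ τ, τ ∈ uIoc 0 t → ‖cutoffMul hκ n (D τ)‖ ≤ C := by
      have h2 := ae_norm_le_eLpNorm_top (hD _ hK isCompact_uIcc)
      rw [ae_restrict_iff' measurableSet_uIcc] at h2
      refine ⟨‖cutoffMul hκ n‖ * (eLpNorm D ∞ (volume.restrict (uIcc 0 T))).toReal, ?_⟩
      filter_upwards [h2] with τ hτ hτI
      exact ((cutoffMul hκ n).le_opNorm _).trans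
        (mul_le_mul_of_nonneg_left (hτ (hsub (uIoc_subset_uIcc hτI))) (norm_nonneg _))
    obtain ⟨C, hC⟩ := hbd
    have hint : IntervalIntegrable (fun τ => cutoffMul hκ n (D τ)) volume 0 t := by
      have h1 := hDint t ht
      exact ⟨(cutoffMul hκ n).integrable_comp h1.1, (cutoffMul hκ n).integrable_comp h1.2⟩
    rw [hcomm t ht, norm_sq_integral_eq hint hC]
    refine (le_abs_self _).trans ?_
    have hvt : IntervalIntegrable (fun t => ‖h t‖ ^ 2) volume 0 t :=
      hvT.mono_set hsub
    have := intervalIntegral.norm_integral_le_abs_of_norm_le (μ := volume) (a := 0) (b := t)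
      (f := fun τ => 2 * inner ℝ (∫ r in (0 : ℝ)..τ, cutoffMul hκ n (D r)) (cutoffMul hκ n (D τ)))
      (g := fun τ => 2 * M * ‖h τ‖ ^ 2) ?_ (hvt.const_mul _)
    · rw [Real.norm_eq_abs] at this
      refine this.trans ?_
      rw [intervalIntegral.integral_const_mul, abs_mul]
      rw [abs_of_nonneg (by positivity : 0 ≤ 2 * M)]
    · rw [ae_restrict_iff' measurableSet_uIoc]
      filter_upwards [hM] with τ hτ hτI
      have hτK := hsub (uIoc_subset_uIcc hτI)
      obtain ⟨h1, F, hF, h2⟩ := hτ hτK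
      rw [← hcomm τ hτK, norm_mul, Real.norm_eq_abs, Real.norm_eq_abs, abs_two]
      have := abs_inner_cutoffMul_le hκ n h1 h2
      have h3 := mul_le_mul_of_nonneg_left hF (norm_nonneg (h τ))
      nlinarith
  have hz : ∫ τ in (0 : ℝ)..T, ‖h τ‖ ^ 2 = 0 := by
    refine integral_eq_zero_of_le_abs_integral (M := 2 * M) hvT (fun t => by positivity) ?_
    filter_upwards [hM] with t ht htI
    have htK := uIoc_subset_uIcc htI
    obtain ⟨h1, -⟩ := ht htK
    refine (Real.le_sqrt (norm_nonneg _)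
      ((sq_nonneg _).trans (hbound 0 t htK))).1 (norm_le_of_cutoffMul hκ h1 fun n => ?_)
    exact Real.le_sqrt_of_sq_le (hbound n t htK)
  refine eq_zero_of_cutoffMul_eq_zero hκ hκ0 fun n => ?_
  have := hbound n T right_mem_uIcc
  rw [hz, abs_zero, mul_zero] at this
  exact norm_eq_zero.1 (pow_eq_zero_iff (two_ne_zero)|>.1 (le_antisymm this (sq_nonneg _)))

/-! ### Functions as tempered distributions -/

theorem Represents.locallyIntegrable {v : ℝ → ℂ} {u : 𝓢'(ℝ, ℂ)} (h : Represents v u) :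
    LocallyIntegrable v := by
  intro x
  let f : ContDiffBump x := ⟨1, 2, one_pos, one_lt_two⟩
  have hf1 : HasCompactSupport (Complex.ofRealCLM ∘ f) := f.hasCompactSupport.comp_left rfl
  have hf2 : ContDiff ℝ ∞ (Complex.ofRealCLM ∘ f) :=
    Complex.ofRealCLM.contDiff.comp f.contDiff
  refine ⟨Metric.closedBall x 1, Metric.closedBall_mem_nhds x one_pos, ?_⟩
  refine ((h (hf1.toSchwartzMap hf2)).1.integrableOn (s := Metric.closedBall x 1)).congr_fun
    (fun y hy => ?_) Metric.isClosed_closedBall.measurableSet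
  have : f y = 1 := f.one_of_mem_closedBall hy
  simp [this]

/-- A tempered distribution determines the function that represents it almost everywhere. -/
theorem Represents.ae_eq {v w : ℝ → ℂ} {u : 𝓢'(ℝ, ℂ)} (hv : Represents v u)
    (hw : Represents w u) : v =ᵐ[volume] w := by
  refine ae_eq_of_integral_contDiff_smul_eq hv.locallyIntegrable hw.locallyIntegrable
    fun g hg hgs => ?_
  have hf1 : HasCompactSupport (Complex.ofRealCLM ∘ g) := hgs.comp_left rfl
  have hf2 : ContDiff ℝ ∞ (Complex.ofRealCLM ∘ g) := Complex.ofRealCLM.contDiff.comp hg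
  have := (hv (hf1.toSchwartzMap hf2)).2.symm.trans (hw (hf1.toSchwartzMap hf2)).2
  simpa [mul_comm] using this

theorem Represents.congr {v w : ℝ → ℂ} {u : 𝓢'(ℝ, ℂ)} (hv : Represents v u)
    (h : v =ᵐ[volume] w) : Represents w u := fun ψ => by
  have h' : (fun x => v x * ψ x) =ᵐ[volume] fun x => w x * ψ x := by
    filter_upwards [h] with x hx
    rw [hx]
  exact ⟨(hv ψ).1.congr h', (hv ψ).2.trans (integral_congr_ae h')⟩

theorem Represents.add {v₁ v₂ : ℝ → ℂ} {u₁ u₂ : 𝓢'(ℝ, ℂ)} (h₁ : Represents v₁ u₁)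
    (h₂ : Represents v₂ u₂) : Represents (fun x => v₁ x + v₂ x) (u₁ + u₂) := fun ψ => by
  simp only [add_mul]
  refine ⟨(h₁ ψ).1.add (h₂ ψ).1, ?_⟩
  rw [integral_add (h₁ ψ).1 (h₂ ψ).1, ← (h₁ ψ).2, ← (h₂ ψ).2]
  rfl

theorem Represents.const_smul {v : ℝ → ℂ} {u : 𝓢'(ℝ, ℂ)} (h : Represents v u) (c : ℂ) :
    Represents (fun x => c * v x) (c • u) := fun ψ => by
  simp only [mul_assoc]
  refine ⟨(h ψ).1.const_mul c, ?_⟩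
  rw [integral_const_mul, ← (h ψ).2]
  rfl

theorem Represents.sub {v₁ v₂ : ℝ → ℂ} {u₁ u₂ : 𝓢'(ℝ, ℂ)} (h₁ : Represents v₁ u₁)
    (h₂ : Represents v₂ u₂) : Represents (fun x => v₁ x - v₂ x) (u₁ - u₂) := fun ψ => by
  simp only [sub_mul]
  refine ⟨(h₁ ψ).1.sub (h₂ ψ).1, ?_⟩
  rw [integral_sub (h₁ ψ).1 (h₂ ψ).1, ← (h₁ ψ).2, ← (h₂ ψ).2]
  rfl

theorem Represents.smulLeftCLM {v : ℝ → ℂ} {u : 𝓢'(ℝ, ℂ)} (h : Represents v u) {k : ℝ → ℂ}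
    (hk : k.HasTemperateGrowth) :
    Represents (fun x => k x * v x) (smulLeftCLM ℂ k u) := fun ψ => by
  have := h (SchwartzMap.smulLeftCLM ℂ k ψ)
  simp only [SchwartzMap.smulLeftCLM_apply_apply hk, smul_eq_mul] at this
  simp only [mul_comm (k _) (v _), mul_assoc]
  exact this

theorem represents_Lp (h : Lp ℂ 2 (volume : Measure ℝ)) : Represents h (h : 𝓢'(ℝ, ℂ)) :=
  fun ψ => ⟨(Lp.memLp h).integrable_mul (ψ.memLp 2), by
    rw [Lp.toTemperedDistribution_apply]
    simp only [smul_eq_mul, mul_comm]⟩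

theorem eq_of_represents {v : ℝ → ℂ} {u w : 𝓢'(ℝ, ℂ)} (hu : Represents v u)
    (hw : Represents v w) : u = w := by
  ext ψ
  rw [(hu ψ).2, (hw ψ).2]

theorem Lp_toTemperedDistribution_injective {f g : Lp ℂ 2 (volume : Measure ℝ)}
    (h : (f : 𝓢'(ℝ, ℂ)) = (g : 𝓢'(ℝ, ℂ))) : f = g := by
  have h2 := represents_Lp g
  rw [← h] at h2
  exact Lp.ext ((represents_Lp f).ae_eq h2)

/-! ### Bessel potentials and the Sobolev embedding -/

/-- The symbol `(1 + |ξ|²)^{s/2}` of the Bessel potential of order `s`, without factors of `2π`, as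
in `TemperedDistribution.besselPotential`. -/
noncomputable def bracket (s ξ : ℝ) : ℝ := (1 + ‖ξ‖ ^ 2) ^ (s / 2)

theorem bracket_pos (s ξ : ℝ) : 0 < bracket s ξ := by unfold bracket; positivity

theorem continuous_bracket (s : ℝ) : Continuous (bracket s) := by
  unfold bracket
  exact (by fun_prop : Continuous fun ξ : ℝ => 1 + ‖ξ‖ ^ 2).rpow_const fun ξ => Or.inl (by positivity)

theorem hasTemperateGrowth_bracket (s : ℝ) :
    (fun ξ : ℝ => (bracket s ξ : ℂ)).HasTemperateGrowth := by
  unfold bracket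
  fun_prop

theorem fourier_besselPotential (s : ℝ) (u : 𝓢'(ℝ, ℂ)) :
    𝓕 (besselPotential ℝ ℂ s u) = smulLeftCLM ℂ (fun ξ : ℝ => (bracket s ξ : ℂ)) (𝓕 u) :=
  fourier_besselPotential_eq_smulLeftCLM_fourier_apply s u

theorem represents_fourier_of_besselPotential {s : ℝ} {u : 𝓢'(ℝ, ℂ)}
    {g : Lp ℂ 2 (volume : Measure ℝ)} (h : besselPotential ℝ ℂ s u = (g : 𝓢'(ℝ, ℂ))) :
    Represents (fun ξ => (bracket (-s) ξ : ℂ) * (𝓕 g : Lp ℂ 2 (volume : Measure ℝ)) ξ) (𝓕 u) := by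
  rw [← (besselPotential_neg_apply_eq_iff s _ _).2 h, fourier_besselPotential,
    Lp.fourier_toTemperedDistribution_eq]
  exact (represents_Lp _).smulLeftCLM (hasTemperateGrowth_bracket _)

theorem memLp_top_bracket_neg {s : ℝ} (hs : 0 ≤ s) :
    MemLp (fun ξ : ℝ => (bracket (-s) ξ : ℂ)) ∞ volume := by
  refine memLp_top_of_bound (C := 1) ((Complex.continuous_ofReal.comp
    (continuous_bracket (-s))).aestronglyMeasurable) (ae_of_all _ fun ξ => ?_)
  rw [Complex.norm_real, Real.norm_of_nonneg (bracket_pos _ _).le]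
  unfold bracket
  exact Real.rpow_le_one_of_one_le_of_nonpos (by simp [sq_nonneg]) (by linarith)

theorem memLp_two_bracket_neg {s : ℝ} (hs : 1 / 2 < s) :
    MemLp (fun ξ : ℝ => (bracket (-s) ξ : ℂ)) 2 volume := by
  have hm : AEStronglyMeasurable (fun ξ : ℝ => (bracket (-s) ξ : ℂ)) volume :=
    (Complex.continuous_ofReal.comp (continuous_bracket (-s))).aestronglyMeasurable
  rw [memLp_two_iff_integrable_sq_norm hm]
  have := integrable_rpow_neg_one_add_norm_sq (E := ℝ) (μ := volume) (r := 2 * s)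
    (by simp; linarith)
  refine this.congr (ae_of_all _ fun ξ => ?_)
  change (1 + ‖ξ‖ ^ 2) ^ (-(2 * s) / 2) = ‖(bracket (-s) ξ : ℂ)‖ ^ 2
  rw [Complex.norm_real, Real.norm_of_nonneg (bracket_pos _ _).le]
  unfold bracket
  rw [← Real.rpow_mul_natCast (by positivity)]
  congr 1
  push_cast
  ring

/-- Multiplication by the bounded symbol `(1 + |ξ|²)^{-s/2}`, `s ≥ 0`, on `L²(ℝ)`. -/
noncomputable def bracketNegMul {s : ℝ} (hs : 0 ≤ s) :
    Lp ℂ 2 (volume : Measure ℝ) →L[ℂ] Lp ℂ 2 (volume : Measure ℝ) :=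
  mulL2 ((memLp_top_bracket_neg hs).toLp _)

theorem coeFn_bracketNegMul {s : ℝ} (hs : 0 ≤ s) (f : Lp ℂ 2 (volume : Measure ℝ)) :
    bracketNegMul hs f =ᵐ[volume] fun ξ => (bracket (-s) ξ : ℂ) * f ξ := by
  filter_upwards [coeFn_mulL2 ((memLp_top_bracket_neg hs).toLp _) f,
    (memLp_top_bracket_neg hs).coeFn_toLp] with ξ h1 h2
  rw [bracketNegMul, h1, h2]

theorem fourier_eq_bracketNegMul {s : ℝ} (hs : 0 ≤ s) {u : 𝓢'(ℝ, ℂ)}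
    {g : Lp ℂ 2 (volume : Measure ℝ)} (h : besselPotential ℝ ℂ s u = (g : 𝓢'(ℝ, ℂ))) :
    𝓕 u = (bracketNegMul hs (𝓕 g) : Lp ℂ 2 (volume : Measure ℝ)) :=
  eq_of_represents (represents_fourier_of_besselPotential h)
    ((represents_Lp _).congr (coeFn_bracketNegMul hs _))

/-- A tempered distribution with integrable Fourier transform `p` is the bounded continuous function
`𝓕⁻ p`. -/
theorem represents_fourierInv_of_integrable {p : ℝ → ℂ} (hp : Integrable p) {u : 𝓢'(ℝ, ℂ)}
    (hu : Represents p (𝓕 u)) : Represents (𝓕⁻ p) u := by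
  intro ψ
  have hcont : Continuous (𝓕⁻ p) := by
    have := (Real.Lp.fourierTransformInv ((memLp_one_iff_integrable.2 hp).toLp p)).continuous
    rwa [Real.Lp.fourierTransformInv_toLp] at this
  constructor
  · refine (ψ.integrable (μ := volume)).bdd_mul (c := ∫ ξ, ‖p ξ‖) hcont.aestronglyMeasurable
      (ae_of_all _ fun x => ?_)
    exact VectorFourier.norm_fourierIntegral_le_integral_norm _ _ _ _ _
  · have h1 := (hu (𝓕⁻ ψ)).2
    rw [TemperedDistribution.fourier_apply, FourierTransform.fourier_fourierInv_eq] at h1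
    rw [h1]
    have h2 := VectorFourier.integral_fourierIntegral_smul_eq_flip (𝕜 := ℝ) (μ := volume)
      (ν := volume) (L := -innerₗ ℝ)
      (f := p) (g := ψ) Real.continuous_fourierChar (by simp; fun_prop) hp
      (ψ.integrable (μ := volume))
    have h3 : (-innerₗ ℝ : ℝ →ₗ[ℝ] ℝ →ₗ[ℝ] ℝ).flip = -innerₗ ℝ := by
      ext; simp
    rw [h3] at h2
    simp only [smul_eq_mul] at h2
    rw [SchwartzMap.fourierInv_coe]
    exact h2.symm

/-- The Sobolev embedding `H^s(ℝ) ⊆ L² ∩ L^∞` for `s > 1/2`, with the `L^∞` bound: the Fourier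
transform of `u` is the product of two `L²` functions, `(1 + |ξ|²)^{-s/2}` and `𝓕 g`, hence
integrable. -/
theorem exists_sobolev_embedding {s : ℝ} (hs : 1 / 2 < s) :
    ∃ C : ℝ, 0 ≤ C ∧ ∀ (u : 𝓢'(ℝ, ℂ)) (g : Lp ℂ 2 (volume : Measure ℝ)),
      besselPotential ℝ ℂ s u = (g : 𝓢'(ℝ, ℂ)) →
      ∃ h : Lp ℂ 2 (volume : Measure ℝ), u = (h : 𝓢'(ℝ, ℂ)) ∧
        𝓕 h = bracketNegMul (by linarith : 0 ≤ s) (𝓕 g) ∧ ∀ᵐ x, ‖h x‖ ≤ C * ‖g‖ := by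
  set b : Lp ℂ 2 (volume : Measure ℝ) := (memLp_two_bracket_neg hs).toLp _ with hb
  refine ⟨‖b‖, norm_nonneg _, fun u g h => ?_⟩
  set H : Lp ℂ 2 (volume : Measure ℝ) := bracketNegMul (by linarith : 0 ≤ s) (𝓕 g) with hH
  have hu : 𝓕 u = (H : 𝓢'(ℝ, ℂ)) := fourier_eq_bracketNegMul _ h
  have hu' : u = ((𝓕⁻ H : Lp ℂ 2 (volume : Measure ℝ)) : 𝓢'(ℝ, ℂ)) := by
    rw [← Lp.fourierInv_toTemperedDistribution_eq, ← hu, FourierTransform.fourierInv_fourier_eq]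
  refine ⟨𝓕⁻ H, hu', FourierTransform.fourier_fourierInv_eq _, ?_⟩
  set p : Lp ℂ 1 (volume : Measure ℝ) := b • (𝓕 g : Lp ℂ 2 (volume : Measure ℝ)) with hp
  have hpae : p =ᵐ[volume] fun ξ => (bracket (-s) ξ : ℂ) *
      (𝓕 g : Lp ℂ 2 (volume : Measure ℝ)) ξ := by
    filter_upwards [Lp.coeFn_lpSMul (r := 1) b (𝓕 g : Lp ℂ 2 (volume : Measure ℝ)),
      (memLp_two_bracket_neg hs).coeFn_toLp] with ξ h1 h2
    rw [h1, Pi.smul_apply', hb, h2, smul_eq_mul]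
  have hrep : Represents (𝓕⁻ (p : ℝ → ℂ)) u := represents_fourierInv_of_integrable
    (L1.integrable_coeFn p) ((represents_fourier_of_besselPotential h).congr hpae.symm)
  have hrep2 := represents_Lp (𝓕⁻ H)
  rw [← hu'] at hrep2
  filter_upwards [hrep.ae_eq hrep2] with x hx
  rw [← hx]
  refine (VectorFourier.norm_fourierIntegral_le_integral_norm _ _ _ _ _).trans ?_
  rw [← L1.norm_eq_integral_norm]
  refine (Lp.norm_smul_le b (𝓕 g : Lp ℂ 2 (volume : Measure ℝ))).trans ?_
  rw [Lp.norm_fourier_eq]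

/-! ### The equation at a fixed time -/

/-- The nonlinearity is Lipschitz in `L²` on sets that are bounded in `L^∞`. -/
theorem exists_nonlinearity_sub {N : ℝ → ℂ → ℂ} {C₀ C₁ ℓ R : ℝ} (hℓ : 0 ≤ ℓ) (hC₁ : 0 ≤ C₁)
    (hN : ∀ᵐ x, ∀ z₁ z₂ : ℂ,
      ‖N x z₁ - N x z₂‖ ≤ (C₀ + C₁ * (‖z₁‖ ^ ℓ + ‖z₂‖ ^ ℓ)) * ‖z₁ - z₂‖)
    {u₁ u₂ B₁ B₂ : 𝓢'(ℝ, ℂ)} {h₁ h₂ : Lp ℂ 2 (volume : Measure ℝ)}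
    (hu₁ : u₁ = (h₁ : 𝓢'(ℝ, ℂ))) (hu₂ : u₂ = (h₂ : 𝓢'(ℝ, ℂ)))
    (hR₁ : ∀ᵐ x, ‖h₁ x‖ ≤ R) (hR₂ : ∀ᵐ x, ‖h₂ x‖ ≤ R)
    (hB₁ : IsNonlinearity N u₁ B₁) (hB₂ : IsNonlinearity N u₂ B₂) :
    ∃ G : Lp ℂ 2 (volume : Measure ℝ), B₁ - B₂ = (G : 𝓢'(ℝ, ℂ)) ∧
      ‖G‖ ≤ (C₀ + C₁ * (R ^ ℓ + R ^ ℓ)) * ‖h₁ - h₂‖ := by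
  obtain ⟨v₁, hv₁, hw₁⟩ := hB₁
  obtain ⟨v₂, hv₂, hw₂⟩ := hB₂
  have hrep := hw₁.sub hw₂
  have e₁ := hv₁.ae_eq (hu₁ ▸ represents_Lp h₁)
  have e₂ := hv₂.ae_eq (hu₂ ▸ represents_Lp h₂)
  have hbd : ∀ᵐ x, ‖N x (v₁ x) - N x (v₂ x)‖ ≤
      (C₀ + C₁ * (R ^ ℓ + R ^ ℓ)) * ‖(h₁ - h₂ : Lp ℂ 2 (volume : Measure ℝ)) x‖ := by
    filter_upwards [hN, e₁, e₂, hR₁, hR₂, Lp.coeFn_sub h₁ h₂] with x hx h1 h2 h3 h4 h5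
    rw [h5, Pi.sub_apply, ← h1, ← h2]
    rw [← h1] at h3
    rw [← h2] at h4
    refine (hx _ _).trans (mul_le_mul_of_nonneg_right ?_ (norm_nonneg _))
    gcongr
  have hmem : MemLp (fun x => N x (v₁ x) - N x (v₂ x)) 2 volume :=
    (Lp.memLp (h₁ - h₂)).of_le_mul hrep.locallyIntegrable.aestronglyMeasurable hbd
  refine ⟨hmem.toLp _, eq_of_represents hrep ((represents_Lp _).congr hmem.coeFn_toLp), ?_⟩
  refine Lp.norm_le_mul_norm_of_ae_le_mul ?_
  filter_upwards [hbd, hmem.coeFn_toLp] with x h1 h2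
  rwa [h2]

/-- The difference of two solutions at a fixed time, on the Fourier side: for `h = u₁ - u₂`, the
equation becomes an identity of functions of `ξ`, whose right-hand side is bounded by `h` in `L²`.
The time derivatives enter through their Bessel potentials of order `-s`, which lie in `L²`. -/
theorem exists_frequency_equation {s : ℝ} {N : ℝ → ℂ → ℂ} {C₀ C₁ ℓ R : ℝ} (hℓ : 0 ≤ ℓ)
    (hC₁ : 0 ≤ C₁)
    (hN : ∀ᵐ x, ∀ z₁ z₂ : ℂ,
      ‖N x z₁ - N x z₂‖ ≤ (C₀ + C₁ * (‖z₁‖ ^ ℓ + ‖z₂‖ ^ ℓ)) * ‖z₁ - z₂‖)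
    {u₁ u₂ u₁' u₂' A₁ A₂ B₁ B₂ : 𝓢'(ℝ, ℂ)} {h₁ h₂ d₁ d₂ : Lp ℂ 2 (volume : Measure ℝ)}
    (hu₁ : u₁ = (h₁ : 𝓢'(ℝ, ℂ))) (hu₂ : u₂ = (h₂ : 𝓢'(ℝ, ℂ)))
    (hR₁ : ∀ᵐ x, ‖h₁ x‖ ≤ R) (hR₂ : ∀ᵐ x, ‖h₂ x‖ ≤ R)
    (hd₁ : besselPotential ℝ ℂ (-s) u₁' = (d₁ : 𝓢'(ℝ, ℂ)))
    (hd₂ : besselPotential ℝ ℂ (-s) u₂' = (d₂ : 𝓢'(ℝ, ℂ)))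
    (hA₁ : IsFracLaplacian s u₁ A₁) (hA₂ : IsFracLaplacian s u₂ A₂)
    (hB₁ : IsNonlinearity N u₁ B₁) (hB₂ : IsNonlinearity N u₂ B₂)
    (heq₁ : Complex.I • u₁' + A₁ = B₁) (heq₂ : Complex.I • u₂' + A₂ = B₂) :
    ∃ F : Lp ℂ 2 (volume : Measure ℝ), ‖F‖ ≤ (C₀ + C₁ * (R ^ ℓ + R ^ ℓ)) * ‖h₁ - h₂‖ ∧
      ∀ᵐ ξ, Complex.I * ((bracket s ξ : ℂ) *
          (𝓕 (d₁ - d₂) : Lp ℂ 2 (volume : Measure ℝ)) ξ) +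
        (((2 * Real.pi * |ξ|) ^ (2 * s) : ℝ) : ℂ) *
          (𝓕 (h₁ - h₂) : Lp ℂ 2 (volume : Measure ℝ)) ξ = F ξ := by
  obtain ⟨G, hG, hGn⟩ := exists_nonlinearity_sub hℓ hC₁ hN hu₁ hu₂ hR₁ hR₂ hB₁ hB₂
  refine ⟨𝓕 G, by rwa [Lp.norm_fourier_eq], ?_⟩
  obtain ⟨v₁, hv₁, hw₁⟩ := hA₁
  obtain ⟨v₂, hv₂, hw₂⟩ := hA₂
  rw [hu₁, Lp.fourier_toTemperedDistribution_eq] at hv₁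
  rw [hu₂, Lp.fourier_toTemperedDistribution_eq] at hv₂
  have e₁ := hv₁.ae_eq (represents_Lp _)
  have e₂ := hv₂.ae_eq (represents_Lp _)
  have k₁ := represents_fourier_of_besselPotential hd₁
  have k₂ := represents_fourier_of_besselPotential hd₂
  rw [neg_neg] at k₁ k₂
  have hl := ((k₁.const_smul Complex.I).add hw₁).sub ((k₂.const_smul Complex.I).add hw₂)
  have hGF : Complex.I • 𝓕 u₁' + 𝓕 A₁ - (Complex.I • 𝓕 u₂' + 𝓕 A₂) =
      ((𝓕 G : Lp ℂ 2 (volume : Measure ℝ)) : 𝓢'(ℝ, ℂ)) := by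
    rw [← Lp.fourier_toTemperedDistribution_eq, ← hG, ← heq₁, ← heq₂]
    simp only [← FourierTransform.fourier_smul, ← FourierTransform.fourier_add]
    exact (map_sub (FourierTransform.fourierCLM ℂ 𝓢'(ℝ, ℂ)) _ _).symm
  rw [hGF] at hl
  have hd : (𝓕 (d₁ - d₂) : Lp ℂ 2 (volume : Measure ℝ)) = 𝓕 d₁ - 𝓕 d₂ :=
    map_sub (Lp.fourierTransformₗᵢ ℝ ℂ) _ _
  have hh : (𝓕 (h₁ - h₂) : Lp ℂ 2 (volume : Measure ℝ)) = 𝓕 h₁ - 𝓕 h₂ :=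
    map_sub (Lp.fourierTransformₗᵢ ℝ ℂ) _ _
  rw [hd, hh]
  filter_upwards [hl.ae_eq (represents_Lp (𝓕 G)), e₁, e₂,
    Lp.coeFn_sub (𝓕 d₁ : Lp ℂ 2 (volume : Measure ℝ)) (𝓕 d₂),
    Lp.coeFn_sub (𝓕 h₁ : Lp ℂ 2 (volume : Measure ℝ)) (𝓕 h₂)] with ξ h1 h2 h3 h4 h5
  rw [← h1, h4, h5, h2, h3, Pi.sub_apply, Pi.sub_apply]
  ring

/-! ### Uniqueness of weak solutions -/

/-- Integration against a fixed Schwartz function, as a functional on `L²(ℝ)`. -/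
noncomputable def pairing (χ : 𝓢(ℝ, ℂ)) : Lp ℂ 2 (volume : Measure ℝ) →L[ℂ] ℂ :=
  (PointwiseConvergenceCLM.evalCLM (RingHom.id ℂ) ℂ χ) ∘L Lp.toTemperedDistributionCLM ℂ volume 2

theorem pairing_apply (χ : 𝓢(ℝ, ℂ)) (f : Lp ℂ 2 (volume : Measure ℝ)) :
    pairing χ f = (f : 𝓢'(ℝ, ℂ)) χ := rfl

theorem besselPotential_apply_apply (σ : ℝ) (χ : 𝓢(ℝ, ℂ)) :
    ∃ ψ : 𝓢(ℝ, ℂ), ∀ u : 𝓢'(ℝ, ℂ), besselPotential ℝ ℂ σ u χ = u ψ :=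
  ⟨_, fun u => fourierMultiplierCLM_apply_apply _ u χ⟩

/-- A weak time derivative whose Bessel potential is locally bounded in `L²` is integrated as a
Bochner integral in `L²`. The scalar weak formulation carries over because Schwartz functions
separate the points of `L²`, and the Bessel potential maps test functions to test functions. -/
theorem HasWeakTimeDeriv.sub_eq_integral {σ : ℝ} {I : Set ℝ} (hI : IsOpen I)
    (hconn : I.OrdConnected) {Φ Φ' : ℝ → 𝓢'(ℝ, ℂ)} (h : HasWeakTimeDeriv I Φ Φ')
    {w d : ℝ → Lp ℂ 2 (volume : Measure ℝ)}
    (hw : ∀ t ∈ I, besselPotential ℝ ℂ σ (Φ t) = (w t : 𝓢'(ℝ, ℂ))) (hwc : ContinuousOn w I)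
    (hd : ∀ᵐ t ∂(volume.restrict I), besselPotential ℝ ℂ σ (Φ' t) = (d t : 𝓢'(ℝ, ℂ)))
    (hdb : ∀ K ⊆ I, IsCompact K → MemLp d ∞ (volume.restrict K))
    {a b : ℝ} (ha : a ∈ I) (hb : b ∈ I) : w b - w a = ∫ t in a..b, d t := by
  have hdi : ∀ K ⊆ I, IsCompact K → IntegrableOn d K := fun K hK hKc =>
    integrableOn_of_memLp_top hKc (hdb K hK hKc)
  refine sub_eq_integral_of_weakDeriv hI hconn hwc hdi (fun η hη hηc hηI => ?_) ha hb
  have hη0 : ∀ t, t ∉ tsupport η → η t = 0 := fun t ht => image_eq_zero_of_notMem_tsupport ht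
  have hη'0 : ∀ t, t ∉ tsupport η → deriv η t = 0 := fun t ht =>
    Function.notMem_support.1 fun h' => ht (support_deriv_subset h')
  have hi1 : Integrable fun t => deriv η t • w t := by
    have : IntegrableOn (fun t => deriv η t • w t) (tsupport η) := by
      refine ContinuousOn.integrableOn_compact hηc ?_
      exact (hη.continuous_deriv (by simp)).continuousOn.smul (hwc.mono hηI)
    exact this.integrable_of_forall_notMem_eq_zero fun t ht => by rw [hη'0 t ht, zero_smul]
  have hi2 : Integrable fun t => η t • d t := by
    have : IntegrableOn (fun t => η t • d t) (tsupport η) :=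
      (hdi _ hηI hηc).continuousOn_smul hη.continuous.continuousOn hηc
    exact this.integrable_of_forall_notMem_eq_zero fun t ht => by rw [hη0 t ht, zero_smul]
  refine Lp_toTemperedDistribution_injective ?_
  ext χ
  obtain ⟨ψ, hψ⟩ := besselPotential_apply_apply σ χ
  rw [← pairing_apply, ← pairing_apply, map_neg, ← (pairing χ).integral_comp_comm hi1,
    ← (pairing χ).integral_comp_comm hi2]
  have e1 : ∀ t, pairing χ (deriv η t • w t) = ((deriv η t : ℝ) : ℂ) * Φ t ψ := by
    intro t
    by_cases ht : t ∈ tsupport η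
    · rw [(pairing χ).map_smul_of_tower, pairing_apply, ← hw t (hηI ht), hψ, Complex.real_smul]
    · rw [hη'0 t ht]; simp
  have e2 : ∀ᵐ t, pairing χ (η t • d t) = ((η t : ℝ) : ℂ) * Φ' t ψ := by
    rw [ae_restrict_iff' hI.measurableSet] at hd
    filter_upwards [hd] with t htI
    by_cases ht : t ∈ tsupport η
    · rw [(pairing χ).map_smul_of_tower, pairing_apply, ← htI (hηI ht), hψ, Complex.real_smul]
    · rw [hη0 t ht]; simp
  rw [integral_congr_ae e2]
  simp only [e1]
  exact h η hη hηc hηI ψ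

/-- Uniqueness of `H^s`-weak solutions, `s > 1/2`, for a nonlinearity with an `x`-independent local
Lipschitz bound. -/
theorem weakSolution_unique {s ℓ C₀ C₁ : ℝ} (hs : 1 / 2 < s) (hℓ : 0 ≤ ℓ) (hC₀ : 0 ≤ C₀)
    (hC₁ : 0 ≤ C₁) {N : ℝ → ℂ → ℂ}
    (hN : ∀ᵐ x, ∀ z₁ z₂ : ℂ,
      ‖N x z₁ - N x z₂‖ ≤ (C₀ + C₁ * (‖z₁‖ ^ ℓ + ‖z₂‖ ^ ℓ)) * ‖z₁ - z₂‖)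
    {φ : 𝓢'(ℝ, ℂ)} {I : Set ℝ} (hI : IsOpen I) (hconn : I.OrdConnected) (h0 : 0 ∈ I)
    {Φ Ψ : ℝ → 𝓢'(ℝ, ℂ)} (hΦ : IsWeakSolution s N φ I Φ) (hΨ : IsWeakSolution s N φ I Ψ) :
    ∀ t ∈ I, Φ t = Ψ t := by
  obtain ⟨g₁, hg₁, hgb₁⟩ := hΦ.mem_Linfty
  obtain ⟨g₂, hg₂, hgb₂⟩ := hΨ.mem_Linfty
  obtain ⟨w₁, hw₁, hwc₁⟩ := hΦ.continuousOn
  obtain ⟨w₂, hw₂, hwc₂⟩ := hΨ.continuousOn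
  obtain ⟨Φ', ⟨d₁, hd₁, hdb₁⟩, hΦ', heq₁⟩ := hΦ.equation
  obtain ⟨Ψ', ⟨d₂, hd₂, hdb₂⟩, hΨ', heq₂⟩ := hΨ.equation
  have hs0 : 0 ≤ s := by linarith
  obtain ⟨CS, hCS0, hCS⟩ := exists_sobolev_embedding hs
  let Fc : Lp ℂ 2 (volume : Measure ℝ) →L[ℂ] Lp ℂ 2 (volume : Measure ℝ) :=
    (Lp.fourierTransformₗᵢ ℝ ℂ).toContinuousLinearEquiv
  have hFc : ∀ f, Fc f = 𝓕 f := fun f => rfl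
  have hw0 : w₁ 0 = w₂ 0 := by
    refine Lp_toTemperedDistribution_injective ?_
    rw [← hw₁ 0 h0, ← hw₂ 0 h0, hΦ.initial, hΨ.initial]
  -- Here `w` is the potential of order `-s` of a solution, `d` that of its time derivative, and `g`
  -- the potential of order `s`; multiplying `𝓕 g` by the symbol of order `-s` gives the Fourier
  -- transform of the solution itself.
  have hmain : ∀ t ∈ I, Fc (w₁ t - w₂ t) = 0 := by
    refine eq_zero_of_energy (κ := bracket s) (m := fun ξ => (2 * Real.pi * |ξ|) ^ (2 * s))
      (W := fun t => Fc (w₁ t - w₂ t)) (D := fun t => Fc (d₁ t - d₂ t))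
      (h := fun t => bracketNegMul hs0 (Fc (g₁ t - g₂ t)))
      (continuous_bracket s) (fun ξ => (bracket_pos s ξ).ne') hconn h0 ?_ ?_ ?_ ?_
    · exact fun K hK hKc => Fc.comp_memLp' ((hdb₁ K hK hKc).sub (hdb₂ K hK hKc))
    · exact fun K hK hKc => ((bracketNegMul hs0).comp Fc).comp_memLp'
        ((hgb₁ K hK hKc).sub (hgb₂ K hK hKc))
    · intro t ht
      have e₁ := hΦ'.sub_eq_integral hI hconn hw₁ hwc₁ hd₁ hdb₁ h0 ht
      have e₂ := hΨ'.sub_eq_integral hI hconn hw₂ hwc₂ hd₂ hdb₂ h0 ht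
      have hsub : uIcc 0 t ⊆ I := hconn.uIcc_subset h0 ht
      have i₁ : IntervalIntegrable d₁ volume 0 t :=
        (integrableOn_of_memLp_top isCompact_uIcc (hdb₁ _ hsub isCompact_uIcc)).intervalIntegrable
      have i₂ : IntervalIntegrable d₂ volume 0 t :=
        (integrableOn_of_memLp_top isCompact_uIcc (hdb₂ _ hsub isCompact_uIcc)).intervalIntegrable
      rw [Fc.intervalIntegral_comp_comm (i₁.sub i₂), intervalIntegral.integral_sub i₁ i₂, ← e₁,
        ← e₂, hw0]
      congr 1
      abel
    · intro K hK hKc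
      set R₁ := (eLpNorm g₁ ∞ (volume.restrict K)).toReal
      set R₂ := (eLpNorm g₂ ∞ (volume.restrict K)).toReal
      -- Both solutions are bounded by `R` at almost every time in `K`.
      set R := CS * max R₁ R₂
      have hR : 0 ≤ R := mul_nonneg hCS0 (le_max_of_le_left ENNReal.toReal_nonneg)
      refine ⟨C₀ + C₁ * (R ^ ℓ + R ^ ℓ), by positivity, ?_⟩
      filter_upwards [ae_restrict_of_ae_restrict_of_subset hK hg₁,
        ae_restrict_of_ae_restrict_of_subset hK hg₂,
        ae_restrict_of_ae_restrict_of_subset hK hd₁,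
        ae_restrict_of_ae_restrict_of_subset hK hd₂,
        ae_restrict_of_ae_restrict_of_subset hK heq₁,
        ae_restrict_of_ae_restrict_of_subset hK heq₂,
        ae_norm_le_eLpNorm_top (hgb₁ K hK hKc), ae_norm_le_eLpNorm_top (hgb₂ K hK hKc),
        ae_restrict_mem hKc.measurableSet]
        with t tg₁ tg₂ td₁ td₂ te₁ te₂ tb₁ tb₂ htK
      obtain ⟨h₁, hu₁, hF₁, hh₁⟩ := hCS _ _ tg₁
      obtain ⟨h₂, hu₂, hF₂, hh₂⟩ := hCS _ _ tg₂
      have hH : bracketNegMul hs0 (Fc (g₁ t - g₂ t)) = Fc (h₁ - h₂) := by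
        rw [map_sub, map_sub, map_sub, hFc, hFc, hFc, hFc, hF₁, hF₂]
      rw [hH]
      constructor
      · have k₁ := represents_fourier_of_besselPotential (hw₁ t (hK htK))
        have k₂ := represents_fourier_of_besselPotential (hw₂ t (hK htK))
        rw [neg_neg] at k₁ k₂
        rw [hu₁, Lp.fourier_toTemperedDistribution_eq] at k₁
        rw [hu₂, Lp.fourier_toTemperedDistribution_eq] at k₂
        rw [map_sub, map_sub]
        filter_upwards [k₁.ae_eq (represents_Lp _), k₂.ae_eq (represents_Lp _),
          Lp.coeFn_sub (Fc h₁) (Fc h₂), Lp.coeFn_sub (Fc (w₁ t)) (Fc (w₂ t))] with ξ h1 h2 h3 h4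
        rw [h3, h4, Pi.sub_apply, Pi.sub_apply, hFc, hFc, hFc, hFc, ← h1, ← h2]
        ring
      · obtain ⟨A₁, B₁, hA₁, hB₁, hE₁⟩ := te₁
        obtain ⟨A₂, B₂, hA₂, hB₂, hE₂⟩ := te₂
        have hR₁ : ∀ᵐ x, ‖h₁ x‖ ≤ R := by
          filter_upwards [hh₁] with x hx
          exact hx.trans (mul_le_mul_of_nonneg_left (tb₁.trans (le_max_left _ _)) hCS0)
        have hR₂ : ∀ᵐ x, ‖h₂ x‖ ≤ R := by
          filter_upwards [hh₂] with x hx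
          exact hx.trans (mul_le_mul_of_nonneg_left (tb₂.trans (le_max_right _ _)) hCS0)
        obtain ⟨F, hFn, hFe⟩ := exists_frequency_equation hℓ hC₁ hN hu₁ hu₂ hR₁ hR₂ td₁ td₂
          hA₁ hA₂ hB₁ hB₂ hE₁ hE₂
        refine ⟨F, ?_, hFe⟩
        rwa [hFc, Lp.norm_fourier_eq]
  intro t ht
  have h1 := hmain t ht
  have h2 : w₁ t = w₂ t := by
    rw [hFc] at h1
    have := Lp.norm_fourier_eq (E := ℝ) (F := ℂ) (w₁ t - w₂ t)
    rw [h1, norm_zero] at this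
    exact sub_eq_zero.1 (norm_eq_zero.1 this.symm)
  have h3 := hw₁ t ht
  rw [h2, ← hw₂ t ht] at h3
  have h4 := congrArg (besselPotential ℝ ℂ s) h3
  simpa using h4

theorem exists_lipschitz_bound {ℓ : ℝ} {V b : ℝ → ℝ} {f : ℝ → ℂ → ℂ} (hb0 : ∀ x, 0 ≤ b x)
    (hfb : ∀ (x : ℝ) (z₁ z₂ : ℂ),
      ‖f x z₁ - f x z₂‖ ≤ b x * (‖z₁‖ ^ ℓ + ‖z₂‖ ^ ℓ) * ‖z₁ - z₂‖)
    (hV : MemLp V ∞ volume) (hb : MemLp b ∞ volume) :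
    ∃ C₀ C₁ : ℝ, 0 ≤ C₀ ∧ 0 ≤ C₁ ∧ ∀ᵐ x, ∀ z₁ z₂ : ℂ,
      ‖((V x : ℂ) * z₁ + f x z₁) - ((V x : ℂ) * z₂ + f x z₂)‖ ≤
        (C₀ + C₁ * (‖z₁‖ ^ ℓ + ‖z₂‖ ^ ℓ)) * ‖z₁ - z₂‖ := by
  refine ⟨(eLpNorm V ∞ volume).toReal, (eLpNorm b ∞ volume).toReal, ENNReal.toReal_nonneg,
    ENNReal.toReal_nonneg, ?_⟩
  filter_upwards [ae_norm_le_eLpNorm_top hV, ae_norm_le_eLpNorm_top hb] with x h1 h2 z₁ z₂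
  have h3 : ((V x : ℂ) * z₁ + f x z₁) - ((V x : ℂ) * z₂ + f x z₂) =
      (V x : ℂ) * (z₁ - z₂) + (f x z₁ - f x z₂) := by ring
  rw [h3, add_mul]
  refine (norm_add_le _ _).trans (add_le_add ?_ ((hfb x z₁ z₂).trans ?_))
  · rw [norm_mul, Complex.norm_real]
    exact mul_le_mul_of_nonneg_right h1 (norm_nonneg _)
  · rw [Real.norm_of_nonneg (hb0 x)] at h2
    gcongr

end FracNLS

theorem proposition4p2 (s ℓ : ℝ) (hs : 1 / 2 < s) (hs1 : s < 1) (hℓ : 0 < ℓ)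
    (V a b : ℝ → ℝ) (f : ℝ → ℂ → ℂ)
    (hVm : Measurable V) (hfm : Measurable (Function.uncurry f))
    (ham : Measurable a) (hbm : Measurable b) (ha0 : ∀ x, 0 ≤ a x) (hb0 : ∀ x, 0 ≤ b x)
    (hphase : ∀ (x : ℝ) (z : ℂ), z ≠ 0 → f x z = z / (‖z‖ : ℂ) * f x (‖z‖ : ℂ))
    (hfa : ∀ (x : ℝ) (z : ℂ), ‖f x z‖ ≤ a x * ‖z‖ ^ (ℓ + 1))
    (hfb : ∀ (x : ℝ) (z₁ z₂ : ℂ),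
      ‖f x z₁ - f x z₂‖ ≤ b x * (‖z₁‖ ^ ℓ + ‖z₂‖ ^ ℓ) * ‖z₁ - z₂‖)
    (p₁ p₂ q₁ q₂ : ℝ≥0∞)
    (hp₁ : ENNReal.ofReal (1 / (2 * s)) < p₁) (hp₂ : ENNReal.ofReal (1 / (2 * s)) < p₂)
    (hq₁ : 1 < q₁) (hq₂ : 1 < q₂)
    (hV : FracNLS.MemLlocAddLp p₁ p₂ V)
    (ha : FracNLS.MemLlocAddLp q₁ q₂ a) (hb : FracNLS.MemLlocAddLp q₁ q₂ b)
    (hVinf : MemLp V ∞ volume) (hbinf : MemLp b ∞ volume)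
    (φ : 𝓢'(ℝ, ℂ)) (hφ : MemSobolev s 2 φ)
    (I : Set ℝ) (hIopen : IsOpen I) (hIconn : I.OrdConnected) (h0 : 0 ∈ I)
    (Φ Ψ : ℝ → 𝓢'(ℝ, ℂ))
    (hΦ : FracNLS.IsWeakSolution s (fun x z => (V x : ℂ) * z + f x z) φ I Φ)
    (hΨ : FracNLS.IsWeakSolution s (fun x z => (V x : ℂ) * z + f x z) φ I Ψ) :
    ∀ t ∈ I, Φ t = Ψ t := by
  obtain ⟨C₀, C₁, hC₀, hC₁, hN⟩ := FracNLS.exists_lipschitz_bound hb0 hfb hVinf hbinf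
  exact FracNLS.weakSolution_unique hs hℓ.le hC₀ hC₁ hN hIopen hIconn h0 hΦ hΨ
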